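/- Let $X=\{0,1\}$, let $X^\omega$ be the set of infinite words over $X$, and let $\lambda$ be the uniform measure on $X^\omega$, i.e. the product over all positions of the uniform probability measures on $\{0,1\}$. Let $a,b$ be the permutations of $X^\omega$ determined by $$a(0w)=0\,b(w),\quad a(1w)=1w,\qquad b(0w)=1\,a(w),\quad b(1w)=0w\qquad(w\in X^\omega),$$ that is, the transformations defined by the two non-trivial states of the three-state automaton that generates the Basilica group, and let $B=\langle a,b\rangle$ be the Basilica group. For $\xi\in X^\omega$ let $\Gamma_\xi$ be the orbital Schreier graph of $\xi$: its vertex set is the orbit $B\cdot\xi$, and every vertex $\eta$ is joined by edges to $a(\eta)$ and to $b(\eta)$; the graph is regarded as an undirected, unlabelled graph. A ray in a graph is an infinite sequence of distinct vertices in which consecutive vertices are adjacent; two rays are equivalent if for every finite set $S$ of vertices both have a tail in the same connected component of the graph with $S$ removed; an end is an equivalence class of rays. Let $E_1$ be the set of all $\xi\in X^\omega$ such that $\Gamma_\xi$ has exactly one end. Then for $\lambda$-almost every $\xi\in X^\omega$ the graph $\Gamma_\xi$ has exactly one end; in particular $\lambda(E_1)=1$. -/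

import Mathlib

open MeasureTheory

/-! ### Rays and ends of a graph -/

namespace SimpleGraph

/-- A ray in a graph: an infinite sequence of distinct vertices such that any two consecutive
vertices are adjacent. -/
structure Ray {V : Type*} (G : SimpleGraph V) where
  vertex : ℕ → V
  injective : Function.Injective vertex
  adj : ∀ n, G.Adj (vertex n) (vertex (n + 1))

namespace Ray

variable {V : Type*} {G : SimpleGraph V}

/-- The ray `R` has a tail contained in the component `C` of `G \ S`. -/
def TailIn (R : G.Ray) {S : Set V} (C : G.ComponentCompl S) : Prop :=
  ∃ n, ∀ i, n ≤ i → R.vertex i ∈ C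

/-- Two rays are equivalent if for every finite set `S` of vertices both of them have a tail in
the same component of `G \ S`. -/
def Equivalent (R R' : G.Ray) : Prop :=
  ∀ S : Finset V, ∃ C : G.ComponentCompl (S : Set V), R.TailIn C ∧ R'.TailIn C

theorem exists_tailIn (R : G.Ray) (S : Finset V) :
    ∃ C : G.ComponentCompl (S : Set V), R.TailIn C := by
  have hfin : (R.vertex ⁻¹' (S : Set V)).Finite :=
    S.finite_toSet.preimage R.injective.injOn
  obtain ⟨m, hm⟩ := hfin.bddAbove
  have hout : ∀ i, m + 1 ≤ i → R.vertex i ∉ (S : Set V) := by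
    intro i hi hmem
    have : i ≤ m := hm hmem
    omega
  refine ⟨G.componentComplMk (hout (m + 1) le_rfl), m + 1, ?_⟩
  intro i hi
  induction i, hi using Nat.le_induction with
  | base => exact G.componentComplMk_mem _
  | succ i hi ih =>
    exact ComponentCompl.mem_of_adj _ _ ih (hout (i + 1) (by omega)) (R.adj i)

theorem TailIn.unique {R : G.Ray} {S : Set V} {C D : G.ComponentCompl S}
    (hC : R.TailIn C) (hD : R.TailIn D) : C = D := by
  obtain ⟨n, hn⟩ := hC
  obtain ⟨m, hm⟩ := hD
  obtain ⟨h₁, e₁⟩ := hn (max n m) (le_max_left _ _)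
  obtain ⟨h₂, e₂⟩ := hm (max n m) (le_max_right _ _)
  exact e₁.symm.trans e₂

/-- Equivalence of rays as a setoid. -/
def setoid (G : SimpleGraph V) : Setoid G.Ray where
  r := Equivalent
  iseqv :=
    { refl := fun R S => by
        obtain ⟨C, hC⟩ := R.exists_tailIn S
        exact ⟨C, hC, hC⟩
      symm := fun h S => by
        obtain ⟨C, h₁, h₂⟩ := h S
        exact ⟨C, h₂, h₁⟩
      trans := fun h h' S => by
        obtain ⟨C, h₁, h₂⟩ := h S
        obtain ⟨D, h₃, h₄⟩ := h' S
        obtain rfl := h₂.unique h₃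
        exact ⟨C, h₁, h₄⟩ }

end Ray

/-- The ends of a graph: equivalence classes of rays. -/
def RayEnds {V : Type*} (G : SimpleGraph V) : Type _ :=
  Quotient (Ray.setoid G)

/-- The number of ends of a graph, possibly infinite. -/
noncomputable def numEnds {V : Type*} (G : SimpleGraph V) : ℕ∞ :=
  ENat.card G.RayEnds

end SimpleGraph

/-- The simple graph underlying a quiver: orientations, labels, loops and multiplicities of the
edges are forgotten. -/
def Quiver.toSimpleGraph (V : Type*) [Quiver V] : SimpleGraph V :=
  SimpleGraph.fromRel fun x y => Nonempty (x ⟶ y)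

namespace Basilica

/-- Infinite words over `{0, 1}`; the letter in position `n` (counted from `0`) of `x` is `x n`. -/
abbrev Word : Type := ℕ → Fin 2

/-- The states of the automaton generating the Basilica group. -/
inductive State : Type
  | a
  | b
  | one

/-- The transition map: the arrows are `a → b`, `b → a` on reading `0`, `a → one`, `b → one` on
reading `1`, and two loops at `one`. -/
def next : State → Fin 2 → State
  | .a, 0 => .b
  | .a, 1 => .one
  | .b, 0 => .a
  | .b, 1 => .one
  | .one, _ => .one

/-- The output map: only the state `b` changes the letter. -/
def out : State → Equiv.Perm (Fin 2)
  | .a => 1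
  | .b => Equiv.swap 0 1
  | .one => 1

/-- The state reached from `s` after reading the first `n` letters of `x`. -/
def stateAfter (s : State) (x : Word) : ℕ → State
  | 0 => s
  | n + 1 => next (stateAfter s x n) (x n)

/-- The state reached from `s` after writing the first `n` letters of `y`. -/
def stateAfterInv (s : State) (y : Word) : ℕ → State
  | 0 => s
  | n + 1 => next (stateAfterInv s y n) ((out (stateAfterInv s y n)).symm (y n))

/-- The word written by the automaton with initial state `s` when reading `x`. -/
def run (s : State) (x : Word) : Word := fun n => out (stateAfter s x n) (x n)

/-- The word read by the automaton with initial state `s` when writing `y`. -/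
def runInv (s : State) (y : Word) : Word := fun n => (out (stateAfterInv s y n)).symm (y n)

theorem stateAfterInv_run (s : State) (x : Word) (n : ℕ) :
    stateAfterInv s (run s x) n = stateAfter s x n := by
  induction n with
  | zero => rfl
  | succ n ih => simp [stateAfterInv, stateAfter, ih, run]

theorem stateAfter_runInv (s : State) (y : Word) (n : ℕ) :
    stateAfter s (runInv s y) n = stateAfterInv s y n := by
  induction n with
  | zero => rfl
  | succ n ih => simp [stateAfterInv, stateAfter, ih, runInv]

/-- The transformation of the boundary `{0,1}^ω` of the binary tree defined by the state `s`. -/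
def transformation (s : State) : Equiv.Perm Word where
  toFun := run s
  invFun := runInv s
  left_inv x := by
    funext n
    simp only [runInv, stateAfterInv_run, run, Equiv.symm_apply_apply]
  right_inv y := by
    funext n
    simp only [run, stateAfter_runInv, runInv, Equiv.apply_symm_apply]

/-- The generator `a = e(b, id)`: it maps `0w` to `0b(w)` and `1w` to `1w`. -/
def a : Equiv.Perm Word := transformation .a

/-- The generator `b = ε(a, id)`: it maps `0w` to `1a(w)` and `1w` to `0w`. -/
def b : Equiv.Perm Word := transformation .b

/-- The Basilica group, acting (faithfully) on the boundary `{0,1}^ω` of the binary tree. -/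
def group : Subgroup (Equiv.Perm Word) := Subgroup.closure {a, b}

/-- The two generators `a`, `b` as elements of the Basilica group. -/
def gen : Fin 2 → group :=
  ![⟨a, Subgroup.subset_closure (by simp)⟩, ⟨b, Subgroup.subset_closure (by simp)⟩]

/-- The vertices of the orbital Schreier graph of `ξ`: the points of the orbit of `ξ`, with one
directed edge `η → gen i • η` for each generator `gen i`. -/
abbrev OrbitalSchreier (ξ : Word) : Type :=
  Quiver.SchreierGraph (MulAction.orbit group ξ) gen

/-- The orbital Schreier graph `Γ_ξ` as an undirected unlabelled graph. -/
def Gam (ξ : Word) : SimpleGraph (OrbitalSchreier ξ) :=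
  Quiver.toSimpleGraph (OrbitalSchreier ξ)

/-- The set `E_i` of all infinite words `ξ` such that `Γ_ξ` has exactly `i` ends. -/
def E (i : ℕ) : Set Word := {ξ | (Gam ξ).numEnds = i}

/-- The uniform measure `λ` on `{0,1}^ω`: the infinite product of the uniform measures on the
letters. -/
noncomputable def uniformMeasure : Measure Word :=
  Measure.infinitePi fun _ : ℕ => (PMF.uniformOfFintype (Fin 2)).toMeasure

end Basilica

/-!
Call `ξ` generic if it has infinitely many letters `1` at even positions and infinitely many at odd
positions; almost every word is generic. For generic `ξ`, let the block at `n` be the finite set of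
vertices of `Γ_ξ` that agree with `ξ` from position `n` on. The blocks exhaust `Γ_ξ`
(`Basilica.Generic.exists_mem_block`), so by `SimpleGraph.Connected.numEnds_eq_one` it suffices
that arbitrarily large blocks have a connected complement
(`Basilica.Generic.preconnected_compl_block`). This holds at the even `n` with `ξ n = 1`.

While it reads zeros, the automaton alternates between the states `a` and `b`, and reading a `1`
sends it to the trivial state. Started in `a`, it is in `a` or `one` at an even position; started
in `b`, it is so at an odd position. Neither state changes a letter, and the letter `1` stops the
automaton, so the block at `n` is preserved by `a` if `n` is even and `ξ n = 1`, and by `b` if `n`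
is odd and `ξ n = 1`. The odd positions show that all cycles of `b` are finite. At an even position,
`b` moves a word out of the block only if the first `n` letters are zeros, so there is one exit `u`,
and likewise at most one `w` outside the block with `b w` inside. The finite cycle of `b` through
`u` leaves the block at `u` and must come back, which it can do only from `w`; it therefore joins
`b u` to `w` outside the block. As these are the only vertices at which a path can leave or enter
the block, the complement is connected.

A ray exists by Kőnig's lemma (`SimpleGraph.Connected.nonempty_ray`), since the orbit is infinite:
by self-similarity any single letter of `ξ` can be changed without leaving the orbit.
-/

/-! ### Rays in infinite graphs and a criterion for one-endedness -/

namespace SimpleGraph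

variable {V : Type*} {G : SimpleGraph V}

/-- Kőnig's lemma. The ray is built from vertices `v` that are passed by geodesics from `o` to
infinitely many vertices `w`; such a vertex has a neighbour of the same kind one step further
from `o`. -/
theorem Connected.nonempty_ray [Infinite V] (hc : G.Connected)
    (hf : ∀ v, (G.neighborSet v).Finite) : Nonempty G.Ray := by
  obtain ⟨o⟩ := hc.nonempty
  let D : V → Set V := fun v => {w | G.dist o w = G.dist o v + G.dist v w}
  have step : ∀ v, (D v).Infinite →
      ∃ v', (D v').Infinite ∧ G.Adj v v' ∧ G.dist o v' = G.dist o v + 1 := by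
    intro v hv
    by_contra! hcon
    refine hv (Set.Finite.subset ((Set.finite_singleton v).union
      (Set.Finite.biUnion (s := {v' ∈ G.neighborSet v | G.dist o v' = G.dist o v + 1})
        ((hf v).subset (Set.sep_subset _ _)) (t := D) ?_)) ?_)
    · rintro v' ⟨h1, h2⟩
      by_contra h3
      exact hcon v' h3 h1 h2
    · intro w hw
      obtain ⟨p, hp⟩ := hc.exists_walk_length_eq_dist v w
      cases p with
      | nil => exact Or.inl rfl
      | @cons _ v' _ hadj q =>
        right
        have hw' : G.dist o w = G.dist o v + G.dist v w := hw
        have h1 : G.dist v' w ≤ q.length := dist_le q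
        have h2 : G.dist o w ≤ G.dist o v' + G.dist v' w := hc.dist_triangle
        have h3 : G.dist o v' ≤ G.dist o v + G.dist v v' := hc.dist_triangle
        have h4 : G.dist v v' = 1 := dist_eq_one_iff_adj.2 hadj
        rw [Walk.length_cons] at hp
        simp only [Set.mem_iUnion]
        refine ⟨v', ⟨hadj, by omega⟩, ?_⟩
        change G.dist o w = G.dist o v' + G.dist v' w
        omega
  have h0 : (D o).Infinite := by
    have : D o = Set.univ := Set.eq_univ_of_forall fun w => by simp [D]
    rw [this]
    exact Set.infinite_univ
  choose f hf1 hf2 hf3 using step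
  let r : ℕ → {v // (D v).Infinite} :=
    fun n => Nat.rec ⟨o, h0⟩ (fun _ v => ⟨f v.1 v.2, hf1 v.1 v.2⟩) n
  have hd : ∀ n, G.dist o (r n).1 = n := by
    intro n
    induction n with
    | zero => simp [r]
    | succ n ih => exact (hf3 (r n).1 (r n).2).trans (by rw [ih])
  exact ⟨⟨fun n => (r n).1, fun m n h => by rw [← hd m, ← hd n]; exact congrArg _ h,
    fun n => hf2 _ _⟩⟩

/-- A connected, locally finite, infinite graph has exactly one end if its finite sets of vertices
are contained in finite sets with connected complement. -/
theorem Connected.numEnds_eq_one [Infinite V] (hc : G.Connected)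
    (hf : ∀ v, (G.neighborSet v).Finite)
    (hK : ∀ S : Finset V, ∃ K : Set V, (S : Set V) ⊆ K ∧ K.Finite ∧ (G.induce Kᶜ).Preconnected) :
    G.numEnds = 1 := by
  obtain ⟨R₀⟩ := hc.nonempty_ray hf
  rw [numEnds, ENat.card_eq_one_iff_unique]
  refine ⟨⟨⟨Quotient.mk _ R₀⟩, fun q => ?_⟩⟩
  induction q using Quotient.ind with | _ R
  refine Quotient.sound fun S => ?_
  obtain ⟨K, hSK, hKf, hKc⟩ := hK S
  obtain ⟨C, n, hC⟩ := R.exists_tailIn S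
  obtain ⟨D, m, hD⟩ := R₀.exists_tailIn S
  have leaves : ∀ (R : G.Ray) (n : ℕ), ∃ i, n ≤ i ∧ R.vertex i ∉ K := by
    intro R n
    by_contra! h
    exact Set.Ici_infinite n ((hKf.preimage R.injective.injOn).subset h)
  obtain ⟨i, hi, hiK⟩ := leaves R n
  obtain ⟨j, hj, hjK⟩ := leaves R₀ m
  obtain ⟨hi', rfl⟩ := hC i hi
  obtain ⟨hj', rfl⟩ := hD j hj
  have hreach := (hKc ⟨_, hiK⟩ ⟨_, hjK⟩).map
    (G.induceHomOfLE (Set.compl_subset_compl.2 hSK)).toHom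
  have : G.componentComplMk hi' = G.componentComplMk hj' := ConnectedComponent.sound hreach
  exact ⟨_, ⟨n, hC⟩, ⟨m, this ▸ hD⟩⟩

end SimpleGraph

namespace Basilica

/-! ### The generators on words with a given tail -/

/-- The finite set of words that agree with `ξ` from position `n` on. -/
def tailSet (ξ : Word) (n : ℕ) : Set Word := {η | ∀ i, n ≤ i → η i = ξ i}

theorem tailSet_mono (ξ : Word) {m n : ℕ} (h : m ≤ n) : tailSet ξ m ⊆ tailSet ξ n :=
  fun _ hη i hi => hη i (h.trans hi)

theorem finite_tailSet (ξ : Word) (n : ℕ) : (tailSet ξ n).Finite := by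
  refine Set.Finite.of_injOn (f := fun (η : Word) (i : Fin n) => η i)
    (t := Set.univ) (fun _ _ => Set.mem_univ _) ?_ Set.finite_univ
  intro η hη η' hη' h
  funext i
  by_cases hi : i < n
  · exact congrFun h ⟨i, hi⟩
  · rw [hη i (by omega), hη' i (by omega)]

theorem fin_two_eq_zero_of_ne_one {c : Fin 2} (h : c ≠ 1) : c = 0 := by omega

theorem stateAfter_one_of_le {s : State} {x : Word} {n : ℕ} (h : stateAfter s x n = .one) {m : ℕ}
    (hm : n ≤ m) : stateAfter s x m = .one := by
  induction m, hm using Nat.le_induction with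
  | base => exact h
  | succ m _ ih => rw [stateAfter, ih]; rfl

theorem run_apply_of_stateAfter_one {s : State} {x : Word} {n : ℕ} (h : stateAfter s x n = .one)
    {i : ℕ} (hi : n ≤ i) : run s x i = x i := by
  rw [run, stateAfter_one_of_le h hi]; rfl

/-- As long as only zeros are read, the automaton started in `a` alternates between `a` and `b`. -/
theorem stateAfter_a (x : Word) (n : ℕ) : stateAfter .a x n = .one ∨
    (∀ i < n, x i = 0) ∧ stateAfter .a x n = if Even n then .a else .b := by
  induction n with
  | zero => right; simp [stateAfter]
  | succ n ih =>
    obtain h | ⟨h0, h⟩ := ih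
    · exact Or.inl (stateAfter_one_of_le h n.le_succ)
    by_cases hx : x n = 1
    · left
      rw [stateAfter, h, hx]
      split_ifs <;> rfl
    · have hx := fin_two_eq_zero_of_ne_one hx
      refine Or.inr ⟨fun i hi => ?_, ?_⟩
      · obtain hi | rfl := Nat.lt_succ_iff_lt_or_eq.1 hi
        exacts [h0 i hi, hx]
      · rw [stateAfter, h, hx]
        by_cases hn : Even n <;> simp [hn, Nat.even_add_one, next]

theorem stateAfter_b (x : Word) (n : ℕ) : stateAfter .b x n = .one ∨
    (∀ i < n, x i = 0) ∧ stateAfter .b x n = if Even n then .b else .a := by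
  induction n with
  | zero => right; simp [stateAfter]
  | succ n ih =>
    obtain h | ⟨h0, h⟩ := ih
    · exact Or.inl (stateAfter_one_of_le h n.le_succ)
    by_cases hx : x n = 1
    · left
      rw [stateAfter, h, hx]
      split_ifs <;> rfl
    · have hx := fin_two_eq_zero_of_ne_one hx
      refine Or.inr ⟨fun i hi => ?_, ?_⟩
      · obtain hi | rfl := Nat.lt_succ_iff_lt_or_eq.1 hi
        exacts [h0 i hi, hx]
      · rw [stateAfter, h, hx]
        by_cases hn : Even n <;> simp [hn, Nat.even_add_one, next]

/-- The states `a` and `one` copy the letter they read, and a letter `1` leads them to `one`. -/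
theorem run_mem_tailSet_iff_of_stateAfter_ne_b {ξ : Word} {n : ℕ} (hξ : ξ n = 1) {s : State}
    {x : Word} (h : stateAfter s x n ≠ .b) : run s x ∈ tailSet ξ n ↔ x ∈ tailSet ξ n := by
  have hcopy : run s x n = x n := by
    rw [run]
    cases hs : stateAfter s x n
    · rfl
    · exact absurd hs h
    · rfl
  have htail : x n = 1 → ∀ i, n ≤ i → run s x i = x i := by
    intro hx i hi
    obtain rfl | hi := hi.eq_or_lt
    · exact hcopy
    refine run_apply_of_stateAfter_one (n := n + 1) ?_ hi
    rw [stateAfter, hx]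
    cases hs : stateAfter s x n
    · rfl
    · exact absurd hs h
    · rfl
  constructor
  · intro hr i hi
    rw [← htail (by rw [← hcopy, hr n le_rfl, hξ]) i hi]
    exact hr i hi
  · intro hr i hi
    rw [htail (by rw [hr n le_rfl, hξ]) i hi]
    exact hr i hi

theorem a_mem_tailSet_iff {ξ : Word} {n : ℕ} (hn : Even n) (hξ : ξ n = 1) (x : Word) :
    a x ∈ tailSet ξ n ↔ x ∈ tailSet ξ n := by
  refine run_mem_tailSet_iff_of_stateAfter_ne_b hξ ?_
  obtain h | ⟨-, h⟩ := stateAfter_a x n <;> simp [h, hn]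

theorem b_mem_tailSet_iff {ξ : Word} {n : ℕ} (hn : ¬Even n) (hξ : ξ n = 1) (x : Word) :
    b x ∈ tailSet ξ n ↔ x ∈ tailSet ξ n := by
  refine run_mem_tailSet_iff_of_stateAfter_ne_b hξ ?_
  obtain h | ⟨-, h⟩ := stateAfter_b x n <;> simp [h, hn]

/-- If `b` moves a word into or out of `tailSet ξ n`, it has not reached the state `one` within the
first `n` letters. -/
theorem apply_eq_zero_of_not_b_mem_tailSet_iff {ξ : Word} {n : ℕ} {x : Word}
    (h : ¬(b x ∈ tailSet ξ n ↔ x ∈ tailSet ξ n)) {i : ℕ} (hi : i < n) : x i = 0 := by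
  obtain h1 | ⟨h0, -⟩ := stateAfter_b x n
  · refine absurd (forall₂_congr fun i hi => ?_) h
    rw [show b x i = x i from run_apply_of_stateAfter_one h1 hi]
  · exact h0 i hi

/-- At most one word of `tailSet ξ n` is moved out of it by `b`. -/
theorem eq_of_b_notMem_tailSet {ξ : Word} {n : ℕ} {x y : Word} (hx : x ∈ tailSet ξ n)
    (hbx : b x ∉ tailSet ξ n) (hy : y ∈ tailSet ξ n) (hby : b y ∉ tailSet ξ n) : x = y := by
  funext i
  by_cases hi : i < n
  · rw [apply_eq_zero_of_not_b_mem_tailSet_iff (x := x) (by tauto) hi,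
      apply_eq_zero_of_not_b_mem_tailSet_iff (x := y) (by tauto) hi]
  · rw [hx i (by omega), hy i (by omega)]

theorem stateAfter_congr {x y : Word} (s : State) {n : ℕ} (h : ∀ i < n, x i = y i) :
    stateAfter s x n = stateAfter s y n := by
  induction n with
  | zero => rfl
  | succ n ih => rw [stateAfter, stateAfter, ih fun i hi => h i (by omega), h n n.lt_succ_self]

/-- At most one word outside `tailSet ξ n` is moved into it by `b`. -/
theorem eq_of_b_mem_tailSet {ξ : Word} {n : ℕ} {x y : Word} (hx : x ∉ tailSet ξ n)
    (hbx : b x ∈ tailSet ξ n) (hy : y ∉ tailSet ξ n) (hby : b y ∈ tailSet ξ n) : x = y := by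
  have h0 : ∀ i < n, x i = y i := fun i hi => by
    rw [apply_eq_zero_of_not_b_mem_tailSet_iff (x := x) (by tauto) hi,
      apply_eq_zero_of_not_b_mem_tailSet_iff (x := y) (by tauto) hi]
  refine b.injective ?_
  funext i
  by_cases hi : i < n
  · change run .b x i = run .b y i
    rw [run, run, h0 i hi, stateAfter_congr .b fun j hj => h0 j (hj.trans hi)]
  · rw [hbx i (by omega), hby i (by omega)]

/-! ### Infinite orbits -/

/-- The word obtained from `w` by putting the letter `c` in front. -/
def cons (c : Fin 2) (w : Word) : Word
  | 0 => c
  | n + 1 => w n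

theorem cons_head_tail (x : Word) : cons (x 0) (fun n => x (n + 1)) = x := by
  funext n; cases n <;> rfl

theorem stateAfter_cons (s : State) (c : Fin 2) (w : Word) (n : ℕ) :
    stateAfter s (cons c w) (n + 1) = stateAfter (next s c) w n := by
  induction n with
  | zero => rfl
  | succ n ih => rw [stateAfter, ih]; rfl

theorem run_cons (s : State) (c : Fin 2) (w : Word) :
    run s (cons c w) = cons (out s c) (run (next s c) w) := by
  funext n
  cases n with
  | zero => rfl
  | succ n => rw [run, stateAfter_cons]; rfl

theorem run_one (w : Word) : run .one w = w :=
  funext fun _ => run_apply_of_stateAfter_one (n := 0) rfl (Nat.zero_le _)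

theorem a_cons_zero (w : Word) : a (cons 0 w) = cons 0 (b w) := run_cons _ _ _

theorem b_cons_zero (w : Word) : b (cons 0 w) = cons 1 (a w) := run_cons _ _ _

theorem b_cons_one (w : Word) : b (cons 1 w) = cons 0 w := by
  refine (run_cons _ _ _).trans ?_
  rw [show next .b 1 = .one from rfl, run_one]
  rfl

/-- Two words are related if they lie in the same orbit of the Basilica group. -/
abbrev OrbitRel : Word → Word → Prop := (MulAction.orbitRel group Word)

theorem orbitRel_a (x : Word) : OrbitRel (a x) x := ⟨gen 0, rfl⟩

theorem orbitRel_b (x : Word) : OrbitRel (b x) x := ⟨gen 1, rfl⟩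

/-- The action of the group below the letter `0` is realized by the elements `a` and `b ^ 2`, which
act there as `b` and `a`. -/
theorem orbitRel_cons_zero {w w' : Word} (h : OrbitRel w' w) :
    OrbitRel (cons 0 w') (cons 0 w) := by
  obtain ⟨⟨g, hg⟩, rfl⟩ := h
  change OrbitRel (cons 0 (g w)) (cons 0 w)
  have equiv := (MulAction.orbitRel group Word).iseqv
  induction hg using Subgroup.closure_induction generalizing w with
  | mem g hg =>
    obtain rfl | rfl := hg
    · refine equiv.trans ?_ (orbitRel_b (cons 0 w))
      rw [b_cons_zero, ← b_cons_one]
      exact orbitRel_b _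
    · exact a_cons_zero w ▸ orbitRel_a _
  | one => exact equiv.refl _
  | mul g h _ _ ihg ihh => exact equiv.trans ihg ihh
  | inv g _ ih => simpa using equiv.symm (ih (w := g⁻¹ w))

theorem orbitRel_cons (c : Fin 2) {w w' : Word} (h : OrbitRel w' w) :
    OrbitRel (cons c w') (cons c w) := by
  have equiv := (MulAction.orbitRel group Word).iseqv
  have hc : ∀ w, OrbitRel (cons c w) (cons 0 w) := by
    intro w
    by_cases hc : c = 1
    · rw [hc]
      exact equiv.symm (b_cons_one w ▸ orbitRel_b _)
    · rw [fin_two_eq_zero_of_ne_one hc]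
  exact equiv.trans (hc w') (equiv.trans (orbitRel_cons_zero h) (equiv.symm (hc w)))

/-- By self-similarity the Basilica group can change a single letter of a word. -/
theorem exists_orbitRel_flip (n : ℕ) (x : Word) :
    ∃ y, OrbitRel y x ∧ y n ≠ x n ∧ ∀ i, n < i → y i = x i := by
  have equiv := (MulAction.orbitRel group Word).iseqv
  induction n generalizing x with
  | zero =>
    rw [← cons_head_tail x]
    generalize (fun n => x (n + 1)) = w
    by_cases hc : x 0 = 1
    · rw [hc]
      refine ⟨_, b_cons_one w ▸ orbitRel_b _, zero_ne_one, ?_⟩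
      rintro (_ | i) hi
      exacts [absurd hi (lt_irrefl 0), rfl]
    · rw [fin_two_eq_zero_of_ne_one hc]
      refine ⟨cons 1 w, equiv.symm (b_cons_one w ▸ orbitRel_b _), one_ne_zero, ?_⟩
      rintro (_ | i) hi
      exacts [absurd hi (lt_irrefl 0), rfl]
  | succ n ih =>
    obtain ⟨y, h1, h2, h3⟩ := ih fun n => x (n + 1)
    refine ⟨cons (x 0) y, ?_, h2, ?_⟩
    · conv => rhs; rw [← cons_head_tail x]
      exact orbitRel_cons _ h1
    · rintro (_ | i) hi
      exacts [rfl, h3 i (by omega)]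

instance infinite_orbit (ξ : Word) : Infinite (MulAction.orbit group ξ) := by
  choose y h1 h2 h3 using fun n => exists_orbitRel_flip n ξ
  refine Infinite.of_injective (fun n => (⟨y n, h1 n⟩ : MulAction.orbit group ξ)) ?_
  intro m n h
  have h : y m = y n := congrArg Subtype.val h
  by_contra hne
  obtain hlt | hlt := Nat.lt_or_gt_of_ne hne
  · exact h2 n (by rw [← h]; exact h3 m n hlt)
  · exact h2 m (by rw [h]; exact h3 n m hlt)

/-! ### The orbital Schreier graph -/

variable {ξ : Word}

instance : Infinite (OrbitalSchreier ξ) :=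
  Infinite.of_injective _ (Quiver.SchreierGraph.equiv (MulAction.orbit group ξ) gen).injective

/-- The word at a vertex of the orbital Schreier graph. -/
def word (v : OrbitalSchreier ξ) : Word := v.toVertex

theorem word_injective : Function.Injective (word : OrbitalSchreier ξ → Word) :=
  Subtype.val_injective.comp (Quiver.SchreierGraph.equiv _ _).symm.injective

/-- The vertex `ξ` of `Γ_ξ`. -/
def root (ξ : Word) : OrbitalSchreier ξ := ⟨⟨ξ, MulAction.mem_orbit_self ξ⟩⟩

/-- A property of vertices that is invariant under both generators holds everywhere on the orbit if
it holds at the root. -/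
theorem vertex_induction {P : OrbitalSchreier ξ → Prop} (root : P (root ξ))
    (hgen : ∀ i v, P (gen i • v) ↔ P v) (v : OrbitalSchreier ξ) : P v := by
  obtain ⟨⟨_, ⟨g, hg⟩, rfl⟩⟩ := v
  have key : ∀ v, P ((⟨g, hg⟩ : group) • v) ↔ P v := by
    induction hg using Subgroup.closure_induction with
    | mem g hg =>
      obtain rfl | rfl := hg
      exacts [hgen 0, hgen 1]
    | one => exact fun v => Iff.of_eq (congrArg P (one_smul group v))
    | mul g h hg hh ihg ihh =>
      intro v
      have := ihg ((⟨h, hh⟩ : group) • v)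
      rw [smul_smul] at this
      exact this.trans (ihh v)
    | inv g hg ih =>
      intro v
      rw [← ih, smul_smul]
      exact Iff.of_eq (congrArg P ((congrArg (· • v) (mul_inv_cancel (⟨g, hg⟩ : group))).trans
        (one_smul group v)))
  exact (key _).2 root

theorem adj_gen_smul {i : Fin 2} {v : OrbitalSchreier ξ} (h : v ≠ gen i • v) :
    (Gam ξ).Adj v (gen i • v) :=
  (SimpleGraph.fromRel_adj _ _ _).2 ⟨h, Or.inl ⟨⟨i, rfl⟩⟩⟩

theorem finite_neighborSet (v : OrbitalSchreier ξ) : ((Gam ξ).neighborSet v).Finite := by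
  refine ((Set.finite_range fun i => gen i • v).union
    (Set.finite_range fun i => (gen i)⁻¹ • v)).subset fun w hw => ?_
  have hadj : (Gam ξ).Adj v w := hw
  obtain ⟨-, ⟨i, hi⟩ | ⟨i, hi⟩⟩ := (SimpleGraph.fromRel_adj _ _ _).1 hadj
  · exact Or.inl ⟨i, hi⟩
  · exact Or.inr ⟨i, inv_smul_eq_iff.2 hi.symm⟩

/-- Outside a set `K` of vertices, the edges labelled by the generators stay available. -/
theorem reachable_gen_smul {K : Set (OrbitalSchreier ξ)} {i : Fin 2} {v : OrbitalSchreier ξ}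
    (hv : v ∈ Kᶜ) (hgv : gen i • v ∈ Kᶜ) :
    ((Gam ξ).induce Kᶜ).Reachable ⟨v, hv⟩ ⟨gen i • v, hgv⟩ := by
  by_cases h : v = gen i • v
  · simp only [← h]
    exact SimpleGraph.Reachable.refl _
  · exact SimpleGraph.Adj.reachable (adj_gen_smul h)

theorem connected_Gam (ξ : Word) : (Gam ξ).Connected := by
  have h : ∀ v, (Gam ξ).Reachable (root ξ) v := vertex_induction (.refl _) fun i v => by
    by_cases h : v = gen i • v
    · rw [← h]
    · have := (adj_gen_smul h).reachable
      exact ⟨fun h => h.trans this.symm, fun h => h.trans this⟩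
  exact (SimpleGraph.connected_iff _).2 ⟨fun u v => (h u).symm.trans (h v), ⟨root ξ⟩⟩

/-- Infinitely many even positions and infinitely many odd positions of `ξ` carry the letter `1`. -/
def Generic (ξ : Word) : Prop :=
  (∀ N, ∃ n, N ≤ n ∧ Even n ∧ ξ n = 1) ∧ ∀ N, ∃ n, N ≤ n ∧ ¬Even n ∧ ξ n = 1

/-- The vertices of `Γ_ξ` that agree with `ξ` from position `n` on. -/
def block (ξ : Word) (n : ℕ) : Set (OrbitalSchreier ξ) := word ⁻¹' tailSet ξ n

theorem finite_block (ξ : Word) (n : ℕ) : (block ξ n).Finite :=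
  (finite_tailSet ξ n).preimage word_injective.injOn

theorem Generic.exists_mem_block (hξ : Generic ξ) (v : OrbitalSchreier ξ) : ∃ n, v ∈ block ξ n := by
  refine vertex_induction (P := fun v => ∃ n, v ∈ block ξ n) ⟨0, fun _ _ => rfl⟩ (fun i v => ?_) v
  have hi : ∀ N, ∃ n, N ≤ n ∧
      ∀ v : OrbitalSchreier ξ, gen i • v ∈ block ξ n ↔ v ∈ block ξ n := by
    intro N
    obtain rfl | rfl : i = 0 ∨ i = 1 := by omega
    · obtain ⟨n, h1, h2, h3⟩ := hξ.1 N
      exact ⟨n, h1, fun v => a_mem_tailSet_iff h2 h3 (word v)⟩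
    · obtain ⟨n, h1, h2, h3⟩ := hξ.2 N
      exact ⟨n, h1, fun v => b_mem_tailSet_iff h2 h3 (word v)⟩
  constructor <;> rintro ⟨m, hm⟩ <;> obtain ⟨n, hmn, hn⟩ := hi m <;>
    have hm' := tailSet_mono ξ hmn hm
  · exact ⟨n, (hn v).1 hm'⟩
  · exact ⟨n, (hn v).2 hm'⟩

/-- The orbits of `b` are finite: for large odd `m` with `ξ m = 1` they do not leave the finite set
`block ξ m`. -/
theorem Generic.exists_b_pow_smul_eq (hξ : Generic ξ) (v : OrbitalSchreier ξ) :
    ∃ N, gen 1 ^ (N + 1) • v = v := by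
  obtain ⟨m₀, hm₀⟩ := hξ.exists_mem_block v
  obtain ⟨m, h1, h2, h3⟩ := hξ.2 m₀
  have hmem : ∀ k : ℕ, gen 1 ^ k • v ∈ block ξ m := by
    intro k
    induction k with
    | zero => rw [pow_zero, one_smul]; exact tailSet_mono ξ h1 hm₀
    | succ k ih => rw [pow_succ', mul_smul]; exact (b_mem_tailSet_iff h2 h3 _).2 ih
  obtain ⟨i, -, j, -, hij, h⟩ := Set.infinite_univ.exists_lt_map_eq_of_mapsTo
    (f := fun k : ℕ => gen 1 ^ k • v) (fun k _ => hmem k) (finite_block ξ m)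
  refine ⟨j - i - 1, ?_⟩
  have hj : j = i + (j - i - 1 + 1) := by omega
  rw [hj, pow_add, mul_smul] at h
  exact (smul_left_cancel _ h).symm

/-- The cycle of `b` through the exit `u` of the block returns to the block at its entry `b w`, and
the part of the cycle in between lies outside the block. -/
theorem Generic.reachable_of_exit_of_entry (hξ : Generic ξ) {n : ℕ} {u w : OrbitalSchreier ξ}
    (hu : u ∈ block ξ n) (hbu : gen 1 • u ∈ (block ξ n)ᶜ) (hw : w ∈ (block ξ n)ᶜ)
    (hbw : gen 1 • w ∈ block ξ n) :
    ((Gam ξ).induce (block ξ n)ᶜ).Reachable ⟨gen 1 • u, hbu⟩ ⟨w, hw⟩ := by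
  classical
  have hex : ∃ p, gen 1 ^ (p + 1) • u ∈ block ξ n := by
    obtain ⟨N, hN⟩ := hξ.exists_b_pow_smul_eq u
    exact ⟨N, hN.symm ▸ hu⟩
  have hp := Nat.find_spec hex
  have hmin := fun k => Nat.find_min hex (m := k)
  generalize Nat.find hex = p at hp hmin
  obtain _ | p := p
  · rw [zero_add, pow_one] at hp
    exact absurd hp hbu
  have hout : ∀ k, (hk : k ≤ p) → ((Gam ξ).induce (block ξ n)ᶜ).Reachable ⟨gen 1 • u, hbu⟩
      ⟨gen 1 ^ (k + 1) • u, hmin k (Nat.lt_succ_of_le hk)⟩ := by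
    intro k hk
    induction k with
    | zero => simp only [zero_add, pow_one]; exact SimpleGraph.Reachable.refl _
    | succ k ih =>
      refine (ih (by omega)).trans ?_
      have h := hmin (k + 1) (Nat.lt_succ_of_le hk)
      simp only [pow_succ' _ (k + 1), mul_smul] at h ⊢
      exact reachable_gen_smul _ h
  rw [pow_succ', mul_smul] at hp
  have hpw : gen 1 ^ (p + 1) • u = w :=
    word_injective (eq_of_b_mem_tailSet (hmin p p.lt_succ_self) hp hw hbw)
  subst hpw
  exact hout p le_rfl

/-- For even `n` with `ξ n = 1` the block is closed under `a`, so it is connected to the rest of the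
graph only by two edges labelled `b`, which lie on the same finite cycle of `b`. -/
theorem Generic.preconnected_compl_block (hξ : Generic ξ) {n : ℕ} (hn : Even n) (h1 : ξ n = 1) :
    ((Gam ξ).induce (block ξ n)ᶜ).Preconnected := by
  have ha : ∀ v : OrbitalSchreier ξ, gen 0 • v ∈ block ξ n ↔ v ∈ block ξ n :=
    fun v => a_mem_tailSet_iff hn h1 (word v)
  have hroot : root ξ ∈ block ξ n := fun _ _ => rfl
  -- Without an exit the block would be invariant, hence the whole graph.
  have exit : ∀ x ∉ block ξ n, ∃ u ∈ block ξ n, gen 1 • u ∉ block ξ n := by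
    intro x hx
    by_contra! hcon
    refine hx (vertex_induction hroot (fun i v => ?_) x)
    obtain rfl | rfl : i = 0 ∨ i = 1 := by omega
    · exact ha v
    · refine ⟨fun hv => ?_, hcon v⟩
      obtain ⟨N, hN⟩ := hξ.exists_b_pow_smul_eq v
      have hk : ∀ k : ℕ, gen 1 ^ (k + 1) • v ∈ block ξ n := by
        intro k
        induction k with
        | zero => rwa [zero_add, pow_one]
        | succ k ih => rw [pow_succ', mul_smul]; exact hcon _ ih
      exact hN ▸ hk N
  rintro ⟨x, hx⟩ ⟨y, hy⟩
  obtain ⟨u, hu, hbu⟩ := exit x hx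
  -- An edge labelled `b` that leaves the block starts at `u`, and one that enters it starts at a
  -- vertex joined to `b u` by the cycle of `b`.
  have key : ∀ v, ∀ hv : v ∈ (block ξ n)ᶜ,
      ((Gam ξ).induce (block ξ n)ᶜ).Reachable ⟨gen 1 • u, hbu⟩ ⟨v, hv⟩ := by
    refine vertex_induction (fun hv => absurd hroot hv) fun i v => ?_
    by_cases hv : v ∈ block ξ n <;> by_cases hgv : gen i • v ∈ block ξ n
    · exact ⟨fun _ h => absurd hv h, fun _ h => absurd hgv h⟩
    · obtain rfl | rfl : i = 0 ∨ i = 1 := by omega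
      · exact absurd ((ha v).2 hv) hgv
      refine ⟨fun _ h => absurd hv h, fun _ h => ?_⟩
      have : u = v := word_injective (eq_of_b_notMem_tailSet hu hbu hv hgv)
      subst this
      exact SimpleGraph.Reachable.refl _
    · obtain rfl | rfl : i = 0 ∨ i = 1 := by omega
      · exact absurd ((ha v).1 hgv) hv
      exact ⟨fun _ h => hξ.reachable_of_exit_of_entry hu hbu h hgv, fun _ h => absurd hgv h⟩
    · have := reachable_gen_smul (K := (block ξ n)) hv hgv
      exact ⟨fun h _ => (h hgv).trans this.symm, fun h _ => (h hv).trans this⟩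
  exact (key x hx).symm.trans (key y hy)

theorem Generic.numEnds_eq_one (hξ : Generic ξ) : (Gam ξ).numEnds = 1 := by
  refine (connected_Gam ξ).numEnds_eq_one finite_neighborSet fun S => ?_
  choose f hf using hξ.exists_mem_block
  obtain ⟨n, hSn, hn, h1⟩ := hξ.1 (S.sup f)
  exact ⟨block ξ n, fun v hv => tailSet_mono ξ ((Finset.le_sup hv).trans hSn) (hf v),
    finite_block ξ n, hξ.preconnected_compl_block hn h1⟩

/-! ### Almost every word -/

instance : IsProbabilityMeasure uniformMeasure := by
  unfold uniformMeasure; infer_instance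

/-- The event that all letters at `m` given positions vanish has measure `2⁻ᵐ`. -/
theorem ae_exists_letter_eq_one {f : ℕ → ℕ} (hf : Function.Injective f) :
    ∀ᵐ ξ ∂uniformMeasure, ∃ k, ξ (f k) = 1 := by
  have bound : ∀ m : ℕ, uniformMeasure {ξ | ¬∃ k, ξ (f k) = 1} ≤ (2⁻¹ : ENNReal) ^ m := by
    intro m
    calc uniformMeasure {ξ | ¬∃ k, ξ (f k) = 1}
        ≤ uniformMeasure (Set.pi ((Finset.range m).map ⟨f, hf⟩ : Finset ℕ) fun _ => {0}) := by
          refine measure_mono fun ξ hξ i hi => ?_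
          simp only [Finset.coe_map, Set.mem_image] at hi
          obtain ⟨k, -, rfl⟩ := hi
          have : ξ (f k) ≠ 1 := fun h => hξ ⟨k, h⟩
          simp only [Function.Embedding.coeFn_mk, Set.mem_singleton_iff]
          omega
      _ = (2⁻¹ : ENNReal) ^ m := by
          rw [uniformMeasure, Measure.infinitePi_pi _ (fun _ _ => MeasurableSet.singleton _)]
          simp
  exact le_antisymm (ge_of_tendsto'
    (ENNReal.tendsto_pow_atTop_nhds_zero_of_lt_one (by simp)) bound) zero_le

theorem ae_frequently_letter_eq_one (e : ℕ) :
    ∀ᵐ ξ ∂uniformMeasure, ∀ N, ∃ k, N ≤ k ∧ ξ (2 * k + e) = 1 := by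
  rw [ae_all_iff]
  intro N
  have hf : Function.Injective fun k => 2 * (N + k) + e := fun x y h => by
    simp only at h
    omega
  filter_upwards [ae_exists_letter_eq_one hf] with ξ ⟨k, hk⟩
  exact ⟨N + k, by omega, hk⟩

theorem ae_generic : ∀ᵐ ξ ∂uniformMeasure, Generic ξ := by
  filter_upwards [ae_frequently_letter_eq_one 0, ae_frequently_letter_eq_one 1] with ξ h0 h1
  refine ⟨fun N => ?_, fun N => ?_⟩
  · obtain ⟨k, hk, h⟩ := h0 N
    exact ⟨2 * k + 0, by omega, by simp, h⟩
  · obtain ⟨k, hk, h⟩ := h1 N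
    exact ⟨2 * k + 1, by omega, by simp, h⟩

end Basilica

theorem mainTheorem7 :
    (∀ᵐ ξ ∂Basilica.uniformMeasure, (Basilica.Gam ξ).numEnds = 1) ∧
      Basilica.uniformMeasure (Basilica.E 1) = 1 := by
  have h : ∀ᵐ ξ ∂Basilica.uniformMeasure, (Basilica.Gam ξ).numEnds = 1 := by
    filter_upwards [Basilica.ae_generic] with ξ hξ using hξ.numEnds_eq_one
  refine ⟨h, ?_⟩
  have hE : ∀ᵐ ξ ∂Basilica.uniformMeasure, ξ ∈ Basilica.E 1 := by
    filter_upwards [h] with ξ hξ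
    simpa [Basilica.E] using hξ
  rw [measure_eq_measure_of_null_sdiff (Set.subset_univ _) (by rwa [← Set.compl_eq_univ_sdiff]),
    measure_univ]
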